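/- For a rational number $r=\frac{p}{q}$ in lowest terms ($q\ge 1$), its encoding length is $\lceil\log_2(|p|+1)\rceil+\lceil\log_2(q+1)\rceil+1$. For a system $A\mathbf x=\mathbf b,\ B\mathbf x\le\mathbf d$ with rational matrices $A\in\mathbb Q^{m_A\times n}$, $B\in\mathbb Q^{m_B\times n}$ and rational vectors $\mathbf b,\mathbf d$, let $\mathcal P=\{\mathbf x\in\mathbb R^n : A\mathbf x=\mathbf b,\ B\mathbf x\le\mathbf d\}$. A circuit is a non-zero vector $\mathbf g\in\ker(A)$ such that $B\mathbf g$ is support-minimal in $\{B\mathbf y:\mathbf y\in\ker(A),\ \mathbf y\ne\mathbf 0\}$, and $\mathcal C(A,B)$ is the set of circuits with co-prime integer components. A circuit-path of length $k$ is a sequence $\mathbf x_0,\dots,\mathbf x_k$ of points of $\mathcal P$ such that for each $i<k$ there are $\mathbf g_i\in\mathcal C(A,B)$ and $t_i>0$ with $\mathbf x_{i+1}=\mathbf x_i+t_i\mathbf g_i\in\mathcal P$ and $\mathbf x_i+(t_i+\varepsilon)\mathbf g_i\notin\mathcal P$ for all $\varepsilon>0$. The circuit-diameter of $\mathcal P$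 (with respect to this description) is the maximum, over all ordered pairs $(\mathbf u,\mathbf v)$ of vertices of $\mathcal P$, of the length of a shortest circuit-path from $\mathbf u$ to $\mathbf v$ (it is $\infty$ if for some pair there is no such path, and $0$ if $\mathcal P$ has no vertex). There is a polynomial $f(m,\alpha)$ such that for all $m_A,m_B,n\ge 0$ and every rational system $A\mathbf x=\mathbf b,\ B\mathbf x\le\mathbf d$ as above with $m=m_A+m_B$ row constraints in $n$ variables, all of whose coefficients (the entries of $A,\mathbf b,B,\mathbf d$) have encoding length at most $\alpha$, the circuit-diameter of $\mathcal P=\{\mathbf x\in\mathbb R^n:A\mathbf x=\mathbf b,\ B\mathbf x\le\mathbf d\}$ is at most $f(m,\alpha)$. -/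

import Mathlib

namespace CircuitPaths

open Matrix

/-- The encoding length of a rational number `p / q` in lowest terms:
`⌈log₂ (|p| + 1)⌉ + ⌈log₂ (q + 1)⌉ + 1` (`Nat.clog 2 k` is `⌈log₂ k⌉` for `1 ≤ k`). -/
def encodingLength (r : ℚ) : ℕ :=
  Nat.clog 2 (r.num.natAbs + 1) + Nat.clog 2 (r.den + 1) + 1

/-- The maximum encoding length among the coefficients (the entries of `A`, `b`, `B`, `d`) of a
rational system `A x = b`, `B x ≤ d`. -/
def maxEncodingLength {mA mB n : ℕ} (A : Matrix (Fin mA) (Fin n) ℚ) (b : Fin mA → ℚ)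
    (B : Matrix (Fin mB) (Fin n) ℚ) (d : Fin mB → ℚ) : ℕ :=
  max
    (max (Finset.univ.sup fun i => Finset.univ.sup fun j => encodingLength (A i j))
      (Finset.univ.sup fun i => encodingLength (b i)))
    (max (Finset.univ.sup fun i => Finset.univ.sup fun j => encodingLength (B i j))
      (Finset.univ.sup fun i => encodingLength (d i)))

/-- The polyhedron `{x ∈ ℝⁿ : A x = b, B x ≤ d}`. -/
def polyhedron {mA mB n : ℕ} (A : Matrix (Fin mA) (Fin n) ℝ) (b : Fin mA → ℝ)
    (B : Matrix (Fin mB) (Fin n) ℝ) (d : Fin mB → ℝ) : Set (Fin n → ℝ) :=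
  {x | A *ᵥ x = b ∧ B *ᵥ x ≤ d}

/-- A circuit: a non-zero `g ∈ ker A` such that `B g` is support-minimal in
`{B y : y ∈ ker A, y ≠ 0}`. -/
def IsCircuit {mA mB n : ℕ} (A : Matrix (Fin mA) (Fin n) ℝ) (B : Matrix (Fin mB) (Fin n) ℝ)
    (g : Fin n → ℝ) : Prop :=
  g ≠ 0 ∧ A *ᵥ g = 0 ∧
    ∀ y : Fin n → ℝ, A *ᵥ y = 0 → y ≠ 0 →
      ¬ Function.support (B *ᵥ y) ⊂ Function.support (B *ᵥ g)

/-- The set `𝒞(A, B)` of circuits with co-prime integer components. -/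
def circuits {mA mB n : ℕ} (A : Matrix (Fin mA) (Fin n) ℝ) (B : Matrix (Fin mB) (Fin n) ℝ) :
    Set (Fin n → ℝ) :=
  {g | IsCircuit A B g ∧
    ∃ z : Fin n → ℤ, (∀ j, g j = (z j : ℝ)) ∧ Finset.univ.gcd z = 1}

/-- `y` arises from `x` by one maximal augmentation along a circuit in `𝒞(A, B)`. -/
def IsAugmentation {mA mB n : ℕ} (A : Matrix (Fin mA) (Fin n) ℝ) (b : Fin mA → ℝ)
    (B : Matrix (Fin mB) (Fin n) ℝ) (d : Fin mB → ℝ) (x y : Fin n → ℝ) : Prop :=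
  ∃ g ∈ circuits A B, ∃ t : ℝ, 0 < t ∧ y = x + t • g ∧
    x + t • g ∈ polyhedron A b B d ∧
    ∀ ε : ℝ, 0 < ε → x + (t + ε) • g ∉ polyhedron A b B d

/-- `x 0, x 1, …, x k` is a circuit-path, of length `k` (the number of augmentations). -/
def IsCircuitPath {mA mB n : ℕ} (A : Matrix (Fin mA) (Fin n) ℝ) (b : Fin mA → ℝ)
    (B : Matrix (Fin mB) (Fin n) ℝ) (d : Fin mB → ℝ) {k : ℕ} (x : Fin (k + 1) → Fin n → ℝ) :
    Prop :=
  (∀ i, x i ∈ polyhedron A b B d) ∧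
    ∀ i : Fin k, IsAugmentation A b B d (x i.castSucc) (x i.succ)

/-- The length of a shortest circuit-path from `u` to `v` (`⊤` if there is none). -/
noncomputable def circuitDist {mA mB n : ℕ} (A : Matrix (Fin mA) (Fin n) ℝ) (b : Fin mA → ℝ)
    (B : Matrix (Fin mB) (Fin n) ℝ) (d : Fin mB → ℝ) (u v : Fin n → ℝ) : ℕ∞ :=
  sInf {l : ℕ∞ | ∃ (k : ℕ) (x : Fin (k + 1) → Fin n → ℝ),
    IsCircuitPath A b B d x ∧ x 0 = u ∧ x (Fin.last k) = v ∧ l = k}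

/-- The circuit-diameter of `{x ∈ ℝⁿ : A x = b, B x ≤ d}`: the maximum length of a shortest
circuit-path between two vertices. -/
noncomputable def circuitDiameter {mA mB n : ℕ} (A : Matrix (Fin mA) (Fin n) ℝ) (b : Fin mA → ℝ)
    (B : Matrix (Fin mB) (Fin n) ℝ) (d : Fin mB → ℝ) : ℕ∞ :=
  ⨆ u ∈ (polyhedron A b B d).extremePoints ℝ, ⨆ v ∈ (polyhedron A b B d).extremePoints ℝ,
    circuitDist A b B d u v

end CircuitPaths

namespace CircuitPaths

open Matrix

/-! ### Paths, and conformal circuits in the kernel of `A` -/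

section Walks

variable {mA mB n : ℕ} {A : Matrix (Fin mA) (Fin n) ℝ} {b : Fin mA → ℝ}
  {B : Matrix (Fin mB) (Fin n) ℝ} {d : Fin mB → ℝ}

/-! Fix the target vertex `v` and measure progress at `x` by the total slack of `x` in the
inequalities tight at `v` (`tightSlack`). This is a nonnegative affine potential that vanishes on
the polyhedron only at `v`.

A conformal decomposition of `v - x` has at most `mB` circuit summands, so one of them accounts for
at least a `1 / mB` fraction of the potential (`exists_isCircuit_le_mul`). Conformality makes the
unit step along it feasible, so the maximal step is at least as long and multiplies the potential by
at most `1 - 1 / mB`. The points reached need not be vertices.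

Cramer's rule (`IsBasic.slack_bounds`) bounds the initial potential above and any nonzero potential
of a basic point below by powers of two with exponents polynomial in `m` and `α`. Polynomially many
greedy steps therefore push the potential below that lower bound `ε`. At most `mB` further steps
inside successively smaller faces, none increasing the potential, then reach a basic point
(`circuitDist_le_of_tightSlack_lt`). Its potential is below `ε`, hence zero, so it is `v`. -/

theorem circuitDist_self {v : Fin n → ℝ} (hv : v ∈ polyhedron A b B d) :
    circuitDist A b B d v v = 0 := by
  refine le_antisymm (sInf_le ⟨0, fun _ => v, ⟨fun _ => hv, fun i => i.elim0⟩, rfl, rfl, ?_⟩) bot_le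
  simp

theorem circuitDist_le_add_one {x y v : Fin n → ℝ} (hx : x ∈ polyhedron A b B d)
    (h : IsAugmentation A b B d x y) :
    circuitDist A b B d x v ≤ circuitDist A b B d y v + 1 := by
  rcases Set.eq_empty_or_nonempty {l : ℕ∞ | ∃ (k : ℕ) (p : Fin (k + 1) → Fin n → ℝ),
    IsCircuitPath A b B d p ∧ p 0 = y ∧ p (Fin.last k) = v ∧ l = k} with he | hne
  · have : circuitDist A b B d y v = ⊤ := by
      unfold circuitDist
      rw [he, sInf_empty]
    simp [this]
  · obtain ⟨k, p, hp, h0, hl, hk⟩ := csInf_mem hne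
    have hk' : circuitDist A b B d y v = k := hk
    rw [hk']
    refine sInf_le ⟨k + 1, Fin.cons x p, ⟨?_, ?_⟩, rfl, ?_, by push_cast; rfl⟩
    · intro i
      refine Fin.cases ?_ (fun i => ?_) i
      · simpa using hx
      · simpa using hp.1 i
    · intro i
      refine Fin.cases ?_ (fun i => ?_) i
      · simpa [h0] using h
      · simpa [← Fin.succ_castSucc] using hp.2 i
    · rw [← Fin.succ_last, Fin.cons_succ, hl]

theorem IsCircuit.smul {g : Fin n → ℝ} (hg : IsCircuit A B g) {t : ℝ} (ht : t ≠ 0) :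
    IsCircuit A B (t • g) := by
  refine ⟨smul_ne_zero ht hg.1, by rw [mulVec_smul, hg.2.1, smul_zero], fun y hy hy0 => ?_⟩
  rw [mulVec_smul, Function.support_const_smul_of_ne_zero _ _ ht]
  exact hg.2.2 y hy hy0

/-- Moving from `a` against `c` until the first coordinate vanishes keeps all signs. -/
theorem exists_sub_smul_conformal {ι : Type*} [Fintype ι] (a c : ι → ℝ)
    (h : ∃ i, 0 < a i * c i) :
    ∃ t : ℝ, 0 < t ∧ (∀ i, 0 ≤ (a i - t * c i) * a i) ∧ ∃ i, a i ≠ 0 ∧ a i - t * c i = 0 := by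
  classical
  obtain ⟨i₀, hi₀⟩ := h
  obtain ⟨j, hj, hmin⟩ := Finset.exists_min_image (Finset.univ.filter fun i => 0 < a i * c i)
    (fun i => a i / c i) ⟨i₀, by simpa using hi₀⟩
  have hj : 0 < a j * c j := by simpa using hj
  have hne : ∀ i, 0 < a i * c i → a i ≠ 0 ∧ c i ≠ 0 := fun i hi =>
    ⟨left_ne_zero_of_mul hi.ne', right_ne_zero_of_mul hi.ne'⟩
  have hq : ∀ i, 0 < a i * c i → 0 < a i / c i := fun i hi => by
    have := (hne i hi).2
    rw [div_eq_mul_inv, show a i * (c i)⁻¹ = a i * c i * ((c i)⁻¹ ^ 2) by field_simp]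
    positivity
  refine ⟨a j / c j, hq j hj, fun i => ?_, j, (hne j hj).1, ?_⟩
  · by_cases hi : 0 < a i * c i
    · have h1 := hmin i (by simpa using hi)
      have h2 : a i * a i = a i / c i * (a i * c i) := by
        have := (hne i hi).2
        field_simp
      nlinarith
    · have := hq j hj
      nlinarith [mul_self_nonneg (a i)]
  · have := (hne j hj).2
    field_simp
    ring

/-- Every nonzero kernel vector admits a circuit that is sign-compatible with it. -/
theorem exists_isCircuit_conformal (hpt : ∀ y, A *ᵥ y = 0 → B *ᵥ y = 0 → y = 0)
    {w : Fin n → ℝ} (hw : A *ᵥ w = 0) (hw0 : w ≠ 0) :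
    ∃ g, IsCircuit A B g ∧ (∀ i, 0 ≤ (B *ᵥ g) i * (B *ᵥ w) i) ∧
      ∀ i, (B *ᵥ w) i = 0 → (B *ᵥ g) i = 0 := by
  classical
  -- Choose `y` with the fewest nonzero rows among the conformal vectors only; `key` upgrades this
  -- to support-minimality among all kernel vectors.
  let Q : ℕ → Prop := fun k => ∃ y, y ≠ 0 ∧ A *ᵥ y = 0 ∧ (∀ i, 0 ≤ (B *ᵥ y) i * (B *ᵥ w) i) ∧
    (∀ i, (B *ᵥ w) i = 0 → (B *ᵥ y) i = 0) ∧ (Finset.univ.filter fun i => (B *ᵥ y) i ≠ 0).card = k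
  have hQ : ∃ k, Q k := ⟨_, w, hw0, hw, fun i => mul_self_nonneg _, fun i h => h, rfl⟩
  obtain ⟨y, hy0, hyA, hyw, hyw0, hyk⟩ := Nat.find_spec hQ
  refine ⟨y, ⟨hy0, hyA, ?_⟩, hyw, hyw0⟩
  -- A `z` of strictly smaller support could be subtracted from `y` until a row vanishes, leaving a
  -- conformal vector with fewer nonzero rows. It is nonzero, since `z` vanishes on some row where
  -- `y` does not.
  have key : ∀ z : Fin n → ℝ, A *ᵥ z = 0 →
      Function.support (B *ᵥ z) ⊂ Function.support (B *ᵥ y) →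
      (∃ i, 0 < (B *ᵥ y) i * (B *ᵥ z) i) → False := by
    intro z hzA hz hi
    obtain ⟨t, ht, hc, j, hj0, hj⟩ := exists_sub_smul_conformal _ _ hi
    have hB : ∀ i, (B *ᵥ (y - t • z)) i = (B *ᵥ y) i - t * (B *ᵥ z) i := fun i => by
      simp [mulVec_sub, mulVec_smul]
    have hz0 : ∀ i, (B *ᵥ y) i = 0 → (B *ᵥ z) i = 0 := fun i h => by
      by_contra h'
      exact (hz.1 (show i ∈ Function.support (B *ᵥ z) from h')) h
    have hsub : ∀ i, (B *ᵥ y) i = 0 → (B *ᵥ (y - t • z)) i = 0 := fun i h => by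
      rw [hB, h, hz0 i h]; ring
    have hlt : (Finset.univ.filter fun i => (B *ᵥ (y - t • z)) i ≠ 0).card < Nat.find hQ := by
      rw [← hyk]
      refine Finset.card_lt_card ⟨fun i => ?_, fun h => ?_⟩
      · simpa using fun h h' => h (hsub i h')
      · have := h (show j ∈ _ by simpa using hj0)
        simp only [Finset.mem_filter] at this
        exact this.2 (by rw [hB, hj])
    refine Nat.find_min hQ hlt ⟨y - t • z, ?_, ?_, ?_, ?_, rfl⟩
    · obtain ⟨i, hi1, hi2⟩ := Set.exists_of_ssubset hz
      intro h0
      have h1 := hB i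
      rw [h0, Function.notMem_support.mp hi2] at h1
      exact hi1 (by simpa using h1.symm)
    · rw [mulVec_sub, mulVec_smul, hyA, hzA]; simp
    · intro i
      by_cases h0 : (B *ᵥ y) i = 0
      · rw [hsub i h0, zero_mul]
      · have h1 := hc i
        rw [← hB] at h1
        have h2 := mul_nonneg h1 (hyw i)
        have h3 : 0 < (B *ᵥ y) i * (B *ᵥ y) i := mul_self_pos.mpr h0
        refine nonneg_of_mul_nonneg_left (b := (B *ᵥ y) i * (B *ᵥ y) i) ?_ h3
        linarith
    · exact fun i h => hsub i (hyw0 i h)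
  intro z hzA hz0 hz
  have hBz : B *ᵥ z ≠ 0 := fun h => hz0 (hpt z hzA h)
  obtain ⟨i, hi⟩ := Function.ne_iff.mp hBz
  have hyi : (B *ᵥ y) i ≠ 0 := hz.1 (show i ∈ Function.support (B *ᵥ z) from hi)
  rcases lt_or_gt_of_ne (mul_ne_zero hyi hi) with h | h
  · refine key (-z) (by rw [mulVec_neg, hzA, neg_zero]) ?_ ⟨i, ?_⟩
    · rwa [mulVec_neg, Function.support_neg]
    · rw [mulVec_neg]
      simpa using h
  · exact key z hzA hz ⟨i, h⟩

/-- Of the at most `k` summands in a conformal circuit decomposition of `w`, one carries at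
least the fraction `1 / k` of the value of a linear functional. -/
theorem exists_isCircuit_le_mul (hpt : ∀ y, A *ᵥ y = 0 → B *ᵥ y = 0 → y = 0)
    (c : (Fin n → ℝ) →ₗ[ℝ] ℝ) (k : ℕ) {w : Fin n → ℝ} (hw : A *ᵥ w = 0) (hw0 : w ≠ 0) (hc0 : 0 ≤ c w)
    (hk : (Finset.univ.filter fun i => (B *ᵥ w) i ≠ 0).card ≤ k) :
    ∃ g, IsCircuit A B g ∧ (∀ i, (B *ᵥ g) i ≤ max 0 ((B *ᵥ w) i)) ∧ c w ≤ k * c g := by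
  classical
  induction k generalizing w with
  | zero =>
    refine absurd (hpt w hw ?_) hw0
    funext i
    have : i ∉ Finset.univ.filter fun i => (B *ᵥ w) i ≠ 0 := by
      rw [Finset.card_eq_zero.mp (Nat.le_zero.mp hk)]; simp
    simpa using this
  | succ k ih =>
    obtain ⟨g, hg, hgw, hgw0⟩ := exists_isCircuit_conformal hpt hw hw0
    have hpos : ∃ i, 0 < (B *ᵥ w) i * (B *ᵥ g) i := by
      obtain ⟨i, hi⟩ := Function.ne_iff.mp fun h => hg.1 (hpt g hg.2.1 h)
      refine ⟨i, lt_of_le_of_ne (by linarith [hgw i]) (Ne.symm (mul_ne_zero ?_ hi))⟩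
      exact fun h => hi (hgw0 i h)
    obtain ⟨t, ht, hc, j, hj0, hj⟩ := exists_sub_smul_conformal _ _ hpos
    have hB : ∀ i, (B *ᵥ (w - t • g)) i = (B *ᵥ w) i - t * (B *ᵥ g) i := fun i => by
      simp [mulVec_sub, mulVec_smul]
    have hle : ∀ i, (B *ᵥ (t • g)) i ≤ max 0 ((B *ᵥ w) i) ∧
        (B *ᵥ (w - t • g)) i ≤ max 0 ((B *ᵥ w) i) := fun i => by
      have h1 := hgw i
      have h2 := hc i
      have h3 := hgw0 i
      rw [hB, mulVec_smul, Pi.smul_apply, smul_eq_mul]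
      rcases lt_trichotomy ((B *ᵥ w) i) 0 with h | h | h
      · have h4 : (B *ᵥ g) i ≤ 0 := by nlinarith
        have h5 : (B *ᵥ w) i - t * (B *ᵥ g) i ≤ 0 := by nlinarith
        exact ⟨le_max_of_le_left (by nlinarith), le_max_of_le_left h5⟩
      · rw [h3 h, h]; simp
      · have h4 : 0 ≤ (B *ᵥ g) i := by nlinarith
        have h5 : 0 ≤ (B *ᵥ w) i - t * (B *ᵥ g) i := by nlinarith
        exact ⟨le_max_of_le_right (by linarith), le_max_of_le_right (by nlinarith)⟩
    -- Either `t • g` carries its share, or more than `k / (k + 1)` of the value remains in `w - t •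
    -- g`, which has at most `k` nonzero rows, and induction applies there.
    by_cases hbig : c w ≤ (k + 1 : ℕ) * c (t • g)
    · exact ⟨t • g, hg.smul ht.ne', fun i => (hle i).1, hbig⟩
    · have hcs : c (w - t • g) = c w - c (t • g) := map_sub _ _ _
      push_cast at hbig
      rw [not_le] at hbig
      have hne : w - t • g ≠ 0 := by
        intro h0
        rw [← sub_eq_zero.mp h0] at hbig
        have := mul_nonneg (Nat.cast_nonneg (α := ℝ) k) hc0
        linarith
      obtain ⟨g', hg', hle', hcg'⟩ := ih (w := w - t • g)
        (by rw [mulVec_sub, mulVec_smul, hw, hg.2.1]; simp) hne (by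
          have := mul_nonneg (Nat.cast_nonneg (α := ℝ) k) hc0
          rw [hcs]
          by_contra hneg
          nlinarith) (by
          refine Nat.le_of_lt_succ (lt_of_lt_of_le (Finset.card_lt_card ⟨fun i => ?_, fun h => ?_⟩) hk)
          · simp only [Finset.mem_filter, Finset.mem_univ, true_and, hB]
            intro h h'
            exact h (by rw [h', hgw0 i h']; ring)
          · have := h (show j ∈ _ by simpa using hj0)
            simp only [Finset.mem_filter] at this
            exact this.2 (by rw [hB, hj]))
      refine ⟨g', hg', fun i => (hle' i).trans (max_le (le_max_left _ _) (hle i).2), ?_⟩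
      have hk0 : (0 : ℝ) ≤ k := Nat.cast_nonneg k
      push_cast
      by_contra hcon
      rw [not_le] at hcon
      nlinarith

end Walks

/-! ### Real circuits rescale to coprime integer vectors -/

section Rationality

variable {mA mB n : ℕ}

/-- A nonzero rational vector is a positive multiple of a primitive integer vector. -/
theorem exists_pos_smul_eq_primitive {n : ℕ} {z : Fin n → ℚ} (hz : z ≠ 0) :
    ∃ s : ℚ, 0 < s ∧ ∃ y : Fin n → ℤ, (∀ j, s * z j = y j) ∧ Finset.univ.gcd y = 1 := by
  obtain ⟨j₀, hj₀⟩ := Function.ne_iff.mp hz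
  let D : ℕ := ∏ j, (z j).den
  have hD : 0 < D := Finset.prod_pos fun j _ => (z j).pos
  have hint : ∀ j, ∃ k : ℤ, (D : ℚ) * z j = k := fun j => by
    obtain ⟨e, he⟩ := Finset.dvd_prod_of_mem (fun j => (z j).den) (Finset.mem_univ j)
    refine ⟨e * (z j).num, ?_⟩
    have h1 : (D : ℚ) = (z j).den * e := by exact_mod_cast he
    push_cast
    rw [h1, ← Rat.mul_den_eq_num (z j)]
    ring
  choose x hx using hint
  obtain ⟨y, hy, hy1⟩ := Finset.extract_gcd x (s := Finset.univ) ⟨j₀, Finset.mem_univ _⟩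
  have hG0 : (0 : ℤ) ≤ Finset.univ.gcd x := by
    exact Int.nonneg_of_normalize_eq_self Finset.normalize_gcd
  have hG : (0 : ℤ) < Finset.univ.gcd x := by
    refine lt_of_le_of_ne hG0 fun h => hj₀ ?_
    have h1 := hy j₀ (Finset.mem_univ _)
    rw [← h, zero_mul] at h1
    have h2 := hx j₀
    rw [h1, Int.cast_zero, mul_eq_zero] at h2
    exact h2.resolve_left (by positivity)
  have hGq : (0 : ℚ) < (Finset.univ.gcd x : ℤ) := by exact_mod_cast hG
  refine ⟨D / (Finset.univ.gcd x : ℤ), div_pos (by exact_mod_cast hD) hGq, y, fun j => ?_, hy1⟩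
  rw [div_mul_eq_mul_div, hx, div_eq_iff hGq.ne', hy j (Finset.mem_univ _)]
  push_cast
  ring

/-- A circuit spans the solution space of a rational homogeneous system: `A` together with the rows
of `B` that vanish on it. That system also has a nonzero rational solution, which must be a multiple
of the circuit. -/
theorem exists_smul_mem_circuits (A : Matrix (Fin mA) (Fin n) ℚ) (B : Matrix (Fin mB) (Fin n) ℚ)
    (hpt : ∀ y : Fin n → ℝ, A.map (fun q => (q : ℝ)) *ᵥ y = 0 →
      B.map (fun q => (q : ℝ)) *ᵥ y = 0 → y = 0)
    {g : Fin n → ℝ} (hg : IsCircuit (A.map fun q => (q : ℝ)) (B.map fun q => (q : ℝ)) g) :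
    ∃ s : ℝ, 0 < s ∧ s • g ∈ circuits (A.map fun q => (q : ℝ)) (B.map fun q => (q : ℝ)) := by
  classical
  set A' : Matrix (Fin mA) (Fin n) ℝ := A.map fun q => (q : ℝ) with hA'
  set B' : Matrix (Fin mB) (Fin n) ℝ := B.map fun q => (q : ℝ) with hB'
  obtain ⟨p, hp⟩ : ∃ p : Fin mB → Prop, ∀ i, p i ↔ (B' *ᵥ g) i = 0 := ⟨_, fun _ => Iff.rfl⟩
  let C : Matrix (Fin mA ⊕ Fin mB) (Fin n) ℚ :=
    fromRows A (of fun i j => if p i then B i j else 0)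
  have hCg : C.map (algebraMap ℚ ℝ) *ᵥ g = 0 := by
    funext i
    rcases i with i | i
    · exact congrFun hg.2.1 i
    · by_cases h : p i
      · rw [Pi.zero_apply, ← (hp i).mp h]
        simp [C, mulVec, dotProduct, h, hB']
      · simp [C, mulVec, dotProduct, h]
  -- Singularity of the Gram matrix is one rational equation, so it descends from ℝ to ℚ;
  -- definiteness of the dot product then gives a rational kernel vector of `C` itself.
  have hdet : (Cᵀ * C).det = 0 := by
    have h1 : ((Cᵀ * C).map (algebraMap ℚ ℝ)).det = 0 := by
      refine exists_mulVec_eq_zero_iff.mp ⟨g, hg.1, ?_⟩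
      rw [Matrix.map_mul, ← mulVec_mulVec, hCg, mulVec_zero]
    rw [← RingHom.mapMatrix_apply, ← RingHom.map_det] at h1
    exact (map_eq_zero _).mp h1
  obtain ⟨z, hz0, hz⟩ := exists_mulVec_eq_zero_iff.mpr hdet
  have hCz : C *ᵥ z = 0 := by
    have h1 : (C *ᵥ z) ⬝ᵥ (C *ᵥ z) = 0 := by
      rw [dotProduct_mulVec, ← mulVec_transpose, mulVec_mulVec, hz, zero_dotProduct]
    exact dotProduct_self_eq_zero.mp h1
  let r : Fin n → ℝ := fun j => (z j : ℝ)
  have hr0 : r ≠ 0 := fun h => hz0 (funext fun j => by simpa [r] using congrFun h j)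
  have hrA : A' *ᵥ r = 0 := by
    funext i
    have := congrFun hCz (Sum.inl i)
    simp only [C, mulVec, dotProduct, fromRows_apply_inl, Pi.zero_apply] at this
    simp only [mulVec, dotProduct, hA', map_apply, r, Pi.zero_apply]
    exact_mod_cast this
  have hrB : ∀ i, (B' *ᵥ g) i = 0 → (B' *ᵥ r) i = 0 := by
    intro i h
    have := congrFun hCz (Sum.inr i)
    simp only [C, mulVec, dotProduct, fromRows_apply_inr, of_apply, if_pos ((hp i).mpr h), Pi.zero_apply] at this
    simp only [mulVec, dotProduct, hB', map_apply, r]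
    exact_mod_cast this
  have hprop : ∃ μ : ℝ, μ ≠ 0 ∧ r = μ • g := by
    obtain ⟨i, hi⟩ := Function.ne_iff.mp fun h => hg.1 (hpt g hg.2.1 h)
    -- Otherwise the difference would be a nonzero kernel vector whose support also loses row `i`,
    -- against minimality.
    have hrg : r = ((B' *ᵥ r) i / (B' *ᵥ g) i) • g := by
      by_contra hne
      have hB : ∀ l, (B' *ᵥ (r - ((B' *ᵥ r) i / (B' *ᵥ g) i) • g)) l =
          (B' *ᵥ r) l - (B' *ᵥ r) i / (B' *ᵥ g) i * (B' *ᵥ g) l := fun l => by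
        simp [mulVec_sub, mulVec_smul]
      refine hg.2.2 _ ?_ (sub_ne_zero.mpr hne) ⟨fun l hl h => hl ?_, fun h => ?_⟩
      · rw [mulVec_sub, mulVec_smul, hrA, hg.2.1]; simp
      · rw [hB, hrB l h, h]; ring
      · refine h (show i ∈ Function.support (B' *ᵥ g) from hi) ?_
        rw [hB]
        have : (B' *ᵥ g) i ≠ 0 := hi
        field_simp
        ring
    refine ⟨_, fun h => hr0 ?_, hrg⟩
    rw [hrg, h, zero_smul]
  obtain ⟨μ, hμ, hrμ⟩ := hprop
  have key : ∀ (z : Fin n → ℚ) (μ : ℝ), 0 < μ → z ≠ 0 → (∀ j, (z j : ℝ) = μ * g j) →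
      ∃ s : ℝ, 0 < s ∧ s • g ∈ circuits A' B' := by
    intro z μ hμ hz hzμ
    obtain ⟨s, hs, y, hy, hy1⟩ := exists_pos_smul_eq_primitive hz
    have hs' : (0 : ℝ) < s := by exact_mod_cast hs
    refine ⟨s * μ, by positivity, hg.smul (by positivity), y, fun j => ?_, hy1⟩
    have h1 : (s : ℝ) * z j = y j := by exact_mod_cast hy j
    rw [← h1, hzμ]
    simp [mul_assoc]
  have hzμ : ∀ j, (z j : ℝ) = μ * g j := fun j => congrFun hrμ j
  rcases lt_or_gt_of_ne hμ with h | h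
  · refine key (-z) (-μ) (by linarith) (neg_ne_zero.mpr hz0) fun j => ?_
    simp [hzμ]
  · exact key z μ h hz0 hzμ

end Rationality

/-! ### Maximal steps, the slack potential, and the two phases of the walk -/

section Walks

variable {mA mB n : ℕ} {A : Matrix (Fin mA) (Fin n) ℝ} {b : Fin mA → ℝ}
  {B : Matrix (Fin mB) (Fin n) ℝ} {d : Fin mB → ℝ}

theorem mulVec_add_smul_apply {m n : ℕ} (M : Matrix (Fin m) (Fin n) ℝ) (x g : Fin n → ℝ) (t : ℝ)
    (i : Fin m) : (M *ᵥ (x + t • g)) i = (M *ᵥ x) i + t * (M *ᵥ g) i := by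
  simp [mulVec_add, mulVec_smul]

theorem add_smul_mem_polyhedron_iff {x g : Fin n → ℝ} (hx : x ∈ polyhedron A b B d)
    (hg : A *ᵥ g = 0) (t : ℝ) :
    x + t • g ∈ polyhedron A b B d ↔ ∀ i, (B *ᵥ x) i + t * (B *ᵥ g) i ≤ d i := by
  constructor
  · intro h i
    rw [← mulVec_add_smul_apply]
    exact h.2 i
  · refine fun h => ⟨by rw [mulVec_add, mulVec_smul, hg, smul_zero, add_zero, hx.1], fun i => ?_⟩
    rw [mulVec_add_smul_apply]
    exact h i

/-- The ratio test: the longest feasible step in a direction that some inequality blocks. -/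
theorem exists_maximal_step {x g : Fin n → ℝ} (hx : x ∈ polyhedron A b B d)
    (hg : A *ᵥ g = 0) (hpos : ∃ i, 0 < (B *ᵥ g) i) :
    ∃ t : ℝ, 0 ≤ t ∧ x + t • g ∈ polyhedron A b B d ∧
      (∀ ε : ℝ, 0 < ε → x + (t + ε) • g ∉ polyhedron A b B d) ∧
      ∃ i, 0 < (B *ᵥ g) i ∧ (B *ᵥ (x + t • g)) i = d i := by
  classical
  obtain ⟨i₀, hi₀⟩ := hpos
  obtain ⟨j, hj, hmin⟩ := Finset.exists_min_image (Finset.univ.filter fun i => 0 < (B *ᵥ g) i)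
    (fun i => (d i - (B *ᵥ x) i) / (B *ᵥ g) i) ⟨i₀, by simpa using hi₀⟩
  have hj : 0 < (B *ᵥ g) j := by simpa using hj
  have ht0 : 0 ≤ (d j - (B *ᵥ x) j) / (B *ᵥ g) j := div_nonneg (sub_nonneg.mpr (hx.2 j)) hj.le
  have htj : (d j - (B *ᵥ x) j) / (B *ᵥ g) j * (B *ᵥ g) j = d j - (B *ᵥ x) j :=
    div_mul_cancel₀ _ hj.ne'
  refine ⟨_, ht0, (add_smul_mem_polyhedron_iff hx hg _).mpr fun i => ?_, fun ε hε h => ?_,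
    j, hj, ?_⟩
  · by_cases hi : 0 < (B *ᵥ g) i
    · have := (le_div_iff₀ hi).mp (hmin i (by simpa using hi))
      linarith
    · have h1 : (B *ᵥ x) i ≤ d i := hx.2 i
      nlinarith
  · have := (add_smul_mem_polyhedron_iff hx hg _).mp h j
    nlinarith
  · rw [mulVec_add_smul_apply, htj]
    ring

/-- Rescaling the direction rescales the step inversely and changes neither the endpoint nor its
maximality, so real circuits may be used as directions. -/
theorem isAugmentation_of_isCircuit
    (hrat : ∀ g, IsCircuit A B g → ∃ s : ℝ, 0 < s ∧ s • g ∈ circuits A B)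
    {x g : Fin n → ℝ} {t : ℝ} (hg : IsCircuit A B g) (ht : 0 < t)
    (hmem : x + t • g ∈ polyhedron A b B d)
    (hmax : ∀ ε : ℝ, 0 < ε → x + (t + ε) • g ∉ polyhedron A b B d) :
    IsAugmentation A b B d x (x + t • g) := by
  obtain ⟨s, hs, hsg⟩ := hrat g hg
  have h1 : (t / s) • s • g = t • g := by rw [smul_smul, div_mul_cancel₀ _ hs.ne']
  refine ⟨s • g, hsg, t / s, by positivity, by rw [h1], by rwa [h1], fun ε hε => ?_⟩
  rw [add_smul, h1, smul_smul, ← add_smul]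
  exact hmax _ (by positivity)

/-- The inequalities and equations that hold with equality at `x` determine it. -/
def IsBasic (A : Matrix (Fin mA) (Fin n) ℝ) (B : Matrix (Fin mB) (Fin n) ℝ) (d : Fin mB → ℝ)
    (x : Fin n → ℝ) : Prop :=
  ∀ w, A *ᵥ w = 0 → (∀ i, (B *ᵥ x) i = d i → (B *ᵥ w) i = 0) → w = 0

theorem IsBasic.eq_zero {x : Fin n → ℝ} (h : IsBasic A B d x) (y : Fin n → ℝ) (hA : A *ᵥ y = 0)
    (hB : B *ᵥ y = 0) : y = 0 :=
  h y hA fun i _ => congrFun hB i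

/-- A direction that keeps the tight rows tight can be followed a little both ways, which would
exhibit the point as a midpoint. -/
theorem isBasic_of_mem_extremePoints {x : Fin n → ℝ}
    (hx : x ∈ (polyhedron A b B d).extremePoints ℝ) : IsBasic A B d x := by
  intro w hA hw
  have hxP := hx.1
  have hev : ∀ᶠ ε in nhds (0 : ℝ), ∀ i, (B *ᵥ x) i + ε * (B *ᵥ w) i ≤ d i := by
    rw [Filter.eventually_all]
    intro i
    by_cases hi : (B *ᵥ x) i = d i
    · simp [hw i hi, hi]
    · have hlt : (B *ᵥ x) i + 0 * (B *ᵥ w) i < d i := by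
        simpa using lt_of_le_of_ne (hxP.2 i) hi
      have hc : Continuous fun ε : ℝ => (B *ᵥ x) i + ε * (B *ᵥ w) i := by fun_prop
      filter_upwards [hc.continuousAt.eventually_lt continuousAt_const hlt] with ε hε using hε.le
  obtain ⟨ε, hε, hball⟩ := Metric.eventually_nhds_iff.mp hev
  have h1 : x + (ε / 2) • w ∈ polyhedron A b B d :=
    (add_smul_mem_polyhedron_iff hxP hA _).mpr (hball (by
      rw [Real.dist_eq, sub_zero, abs_of_pos (by linarith)]; linarith))
  have h2 : x + (-(ε / 2)) • w ∈ polyhedron A b B d :=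
    (add_smul_mem_polyhedron_iff hxP hA _).mpr (hball (by
      rw [Real.dist_eq, sub_zero, abs_neg, abs_of_pos (by linarith)]; linarith))
  have h3 := hx.2 h1 h2 ⟨1 / 2, 1 / 2, by norm_num, by norm_num, by norm_num, by
    ext j; simp; ring⟩
  have h4 : (ε / 2) • w = 0 := by simpa using h3
  exact (smul_eq_zero.mp h4).resolve_left (by linarith)

/-- The total slack at `x` in the inequalities that are tight at `v`. -/
noncomputable def tightSlack (B : Matrix (Fin mB) (Fin n) ℝ) (d : Fin mB → ℝ) (v x : Fin n → ℝ) :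
    ℝ :=
  ∑ i with (B *ᵥ v) i = d i, (d i - (B *ᵥ x) i)

/-- The sum of the left-hand sides of the inequalities that are tight at `v`. -/
noncomputable def tightSum (B : Matrix (Fin mB) (Fin n) ℝ) (d : Fin mB → ℝ) (v : Fin n → ℝ) :
    (Fin n → ℝ) →ₗ[ℝ] ℝ :=
  ∑ i with (B *ᵥ v) i = d i, LinearMap.proj i ∘ₗ B.mulVecLin

theorem tightSum_apply (v x : Fin n → ℝ) :
    tightSum B d v x = ∑ i with (B *ᵥ v) i = d i, (B *ᵥ x) i := by
  simp [tightSum, LinearMap.sum_apply]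

theorem tightSlack_nonneg {v x : Fin n → ℝ} (hx : x ∈ polyhedron A b B d) :
    0 ≤ tightSlack B d v x :=
  Finset.sum_nonneg fun i _ => sub_nonneg.mpr (hx.2 i)

theorem tightSlack_add_smul (v x g : Fin n → ℝ) (t : ℝ) :
    tightSlack B d v (x + t • g) = tightSlack B d v x - t * tightSum B d v g := by
  rw [tightSum_apply, tightSlack, tightSlack, Finset.mul_sum, ← Finset.sum_sub_distrib]
  refine Finset.sum_congr rfl fun i _ => ?_
  rw [mulVec_add_smul_apply]
  ring

theorem tightSum_sub (v x : Fin n → ℝ) : tightSum B d v (v - x) = tightSlack B d v x := by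
  rw [tightSum_apply, tightSlack]
  refine Finset.sum_congr rfl fun i hi => ?_
  rw [← (Finset.mem_filter.mp hi).2]
  simp [mulVec_sub]

theorem exists_pos_of_tightSum_pos {v g : Fin n → ℝ} (h : 0 < tightSum B d v g) :
    ∃ i, 0 < (B *ᵥ g) i := by
  rw [tightSum_apply] at h
  by_contra! hcon
  exact h.not_ge (Finset.sum_nonpos fun i _ => hcon i)

theorem eq_of_tightSlack_eq_zero {v x : Fin n → ℝ} (hv : v ∈ polyhedron A b B d)
    (hvb : IsBasic A B d v) (hx : x ∈ polyhedron A b B d) (h : tightSlack B d v x = 0) :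
    x = v := by
  have h1 := (Finset.sum_eq_zero_iff_of_nonneg fun i _ => sub_nonneg.mpr (hx.2 i)).mp h
  refine sub_eq_zero.mp (hvb _ (by rw [mulVec_sub, hx.1, hv.1, sub_self]) fun i hi => ?_)
  have h2 := h1 i (by simpa using hi)
  rw [mulVec_sub, Pi.sub_apply, hi]
  linarith

/-- From a point with small slack, circuit steps that make new inequalities tight lead to `v`. -/
theorem circuitDist_le_of_tightSlack_lt
    (hrat : ∀ g, IsCircuit A B g → ∃ s : ℝ, 0 < s ∧ s • g ∈ circuits A B)
    {v : Fin n → ℝ} (hv : v ∈ polyhedron A b B d) (hvb : IsBasic A B d v) {ε : ℝ}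
    (hε : ∀ x ∈ polyhedron A b B d, IsBasic A B d x → tightSlack B d v x < ε →
      tightSlack B d v x = 0) (k : ℕ) {x : Fin n → ℝ} (hx : x ∈ polyhedron A b B d)
    (hxε : tightSlack B d v x < ε)
    (hk : (Finset.univ.filter fun i => (B *ᵥ x) i ≠ d i).card ≤ k) :
    circuitDist A b B d x v ≤ k := by
  classical
  induction k generalizing x with
  | zero =>
    have hb : IsBasic A B d x := fun w hA hw => hvb.eq_zero w hA (funext fun i => hw i (by
      have : i ∉ Finset.univ.filter fun i => (B *ᵥ x) i ≠ d i := by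
        rw [Finset.card_eq_zero.mp (Nat.le_zero.mp hk)]; simp
      simpa using this))
    rw [eq_of_tightSlack_eq_zero hv hvb hx (hε x hx hb hxε), circuitDist_self hv]
    simp
  | succ k ih =>
    by_cases hb : IsBasic A B d x
    · rw [eq_of_tightSlack_eq_zero hv hvb hx (hε x hx hb hxε), circuitDist_self hv]
      simp
    · unfold IsBasic at hb
      push Not at hb
      obtain ⟨w, hA, hw, hw0⟩ := hb
      obtain ⟨g₀, hg₀, -, hg₀w⟩ := exists_isCircuit_conformal hvb.eq_zero hA hw0
      -- The sign of the circuit is chosen so that the potential does not increase. If the potential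
      -- is constant along it, the sign is chosen so that some inequality blocks the move.
      obtain ⟨g, hg, hgt, hcg, hgpos⟩ : ∃ g, IsCircuit A B g ∧
          (∀ i, (B *ᵥ x) i = d i → (B *ᵥ g) i = 0) ∧ 0 ≤ tightSum B d v g ∧
          ∃ i, 0 < (B *ᵥ g) i := by
        obtain ⟨i, hi⟩ := Function.ne_iff.mp fun h => hg₀.1 (hvb.eq_zero g₀ hg₀.2.1 h)
        have hneg : IsCircuit A B (-g₀) := by
          simpa using hg₀.smul (t := -1) (by norm_num)
        have ht₀ : ∀ i, (B *ᵥ x) i = d i → (B *ᵥ g₀) i = 0 := fun i hi => hg₀w i (hw i hi)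
        have htn : ∀ i, (B *ᵥ x) i = d i → (B *ᵥ (-g₀)) i = 0 := fun i hi => by
          simp [mulVec_neg, ht₀ i hi]
        rcases lt_trichotomy (tightSum B d v g₀) 0 with h | h | h
        · have h' : 0 < tightSum B d v (-g₀) := by rw [map_neg]; linarith
          exact ⟨-g₀, hneg, htn, h'.le, exists_pos_of_tightSum_pos h'⟩
        · rcases lt_or_gt_of_ne hi with hi | hi
          · exact ⟨-g₀, hneg, htn, by rw [map_neg, h, neg_zero], i, by
              simpa [mulVec_neg] using hi⟩
          · exact ⟨g₀, hg₀, ht₀, h.ge, i, hi⟩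
        · exact ⟨g₀, hg₀, ht₀, h.le, exists_pos_of_tightSum_pos h⟩
      obtain ⟨t, ht, hmem, hmax, j, hj, hjt⟩ := exists_maximal_step hx hg.2.1 hgpos
      -- The blocking row was not tight before: rows tight at `x` are constant along `g`. Hence the
      -- step is positive and row `j` is newly tight.
      have hjx : (B *ᵥ x) j ≠ d j := fun h => hj.ne' (hgt j h)
      have ht' : 0 < t := by
        refine lt_of_le_of_ne ht fun h => hjx ?_
        rw [← hjt, ← h, zero_smul, add_zero]
      have h1 := ih hmem (by
          rw [tightSlack_add_smul]
          have := mul_nonneg ht hcg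
          linarith) (by
        refine Nat.le_of_lt_succ (lt_of_lt_of_le (Finset.card_lt_card ⟨fun i => ?_, fun h => ?_⟩) hk)
        · simp only [Finset.mem_filter, Finset.mem_univ, true_and]
          intro h h'
          exact h (by rw [mulVec_add_smul_apply, hgt i h', h']; ring)
        · have := h (show j ∈ _ by simpa using hjx)
          simp only [Finset.mem_filter] at this
          exact this.2 hjt)
      refine (circuitDist_le_add_one hx
        (isAugmentation_of_isCircuit hrat hg ht' hmem hmax)).trans ?_
      push_cast
      gcongr

/-- Greedy circuit steps shrink the slack geometrically. -/
theorem circuitDist_le_of_tightSlack_mul_pow_lt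
    (hrat : ∀ g, IsCircuit A B g → ∃ s : ℝ, 0 < s ∧ s • g ∈ circuits A B)
    {v : Fin n → ℝ} (hv : v ∈ polyhedron A b B d) (hvb : IsBasic A B d v) {ε : ℝ}
    (hε : ∀ x ∈ polyhedron A b B d, IsBasic A B d x → tightSlack B d v x < ε →
      tightSlack B d v x = 0) (N : ℕ) {x : Fin n → ℝ} (hx : x ∈ polyhedron A b B d)
    (hxε : tightSlack B d v x * (1 - 1 / mB) ^ N < ε) :
    circuitDist A b B d x v ≤ N + mB := by
  classical
  induction N generalizing x with
  | zero =>
    have := circuitDist_le_of_tightSlack_lt hrat hv hvb hε mB hx (by simpa using hxε)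
      ((Finset.card_le_univ _).trans (by simp))
    simpa using this
  | succ N ih =>
    rcases (tightSlack_nonneg (v := v) hx).eq_or_lt with h0 | hpos
    · rw [eq_of_tightSlack_eq_zero hv hvb hx h0.symm, circuitDist_self hv]
      simp
    have hne : v - x ≠ 0 := fun h => by
      rw [← tightSum_sub, h, map_zero] at hpos
      exact hpos.false
    obtain ⟨g, hg, hgw, hcg⟩ := exists_isCircuit_le_mul (B := B) hvb.eq_zero (tightSum B d v) mB
      (by rw [mulVec_sub, hx.1, hv.1, sub_self]) hne (by rw [tightSum_sub]; exact hpos.le)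
      ((Finset.card_le_univ _).trans (by simp))
    rw [tightSum_sub] at hcg
    have hprod : (0 : ℝ) < mB * tightSum B d v g := hpos.trans_le hcg
    have hcg0 : 0 < tightSum B d v g := pos_of_mul_pos_right hprod (Nat.cast_nonneg _)
    have hmB : (0 : ℝ) < mB := pos_of_mul_pos_left hprod hcg0.le
    obtain ⟨t, ht, hmem, hmax, -⟩ :=
      exists_maximal_step hx hg.2.1 (exists_pos_of_tightSum_pos hcg0)
    -- Since `B g ≤ max 0 (B (v - x))`, each row of `B (x + g)` is at most the larger of its values
    -- at `x` and `v`, so the unit step is feasible.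
    have ht1 : 1 ≤ t := by
      by_contra hlt
      refine hmax (1 - t) (by linarith) ?_
      rw [add_smul_mem_polyhedron_iff hx hg.2.1]
      intro i
      have h1 := hgw i
      have h2 : (B *ᵥ x) i ≤ d i := hx.2 i
      have h3 : (B *ᵥ v) i ≤ d i := hv.2 i
      rw [mulVec_sub, Pi.sub_apply] at h1
      rcases le_max_iff.mp h1 with h | h <;> linarith
    have hle : tightSlack B d v (x + t • g) ≤ tightSlack B d v x * (1 - 1 / mB) := by
      rw [tightSlack_add_smul]
      have h1 : tightSlack B d v x / mB ≤ tightSum B d v g := by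
        rw [div_le_iff₀ hmB]; linarith
      have h2 : tightSum B d v g ≤ t * tightSum B d v g := le_mul_of_one_le_left hcg0.le ht1
      have h3 : tightSlack B d v x * (1 - 1 / mB) =
        tightSlack B d v x - tightSlack B d v x / mB := by ring
      linarith
    have hfrac : (0 : ℝ) ≤ 1 - 1 / mB := by
      have h1 : (1 : ℝ) ≤ mB := by exact_mod_cast hmB
      rw [sub_nonneg, div_le_one hmB]
      exact h1
    have h1 := ih hmem (lt_of_le_of_lt (mul_le_mul_of_nonneg_right hle (pow_nonneg hfrac N)) (by
      rw [mul_assoc, ← pow_succ']; exact hxε))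
    refine (circuitDist_le_add_one hx (isAugmentation_of_isCircuit hrat hg
      (by linarith) hmem hmax)).trans ?_
    push_cast
    rw [add_right_comm]
    gcongr

end Walks

/-! ### Size bounds from Cramer's rule -/

section Bounds

/-- Cramer's rule for the normal equations of an integer system of full column rank, with bounds
on the numerators and on the common denominator. -/
theorem exists_int_solution_bound {ι : Type*} [Fintype ι] {n : ℕ} (N : Matrix ι (Fin n) ℤ)
    (h : ι → ℤ) (K : ℤ) (hN : ∀ i j, |N i j| ≤ K) (hh : ∀ i, |h i| ≤ K) (x : Fin n → ℝ)
    (hx : N.map (Int.cast : ℤ → ℝ) *ᵥ x = fun i => (h i : ℝ))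
    (hinj : ∀ y, N.map (Int.cast : ℤ → ℝ) *ᵥ y = 0 → y = 0) :
    ∃ (Z : ℤ) (q : Fin n → ℤ), Z ≠ 0 ∧ |Z| ≤ n.factorial * (Fintype.card ι * K ^ 2) ^ n ∧
      (∀ j, |q j| ≤ n.factorial * (Fintype.card ι * K ^ 2) ^ n) ∧
      ∀ j, (Z : ℝ) * x j = q j := by
  classical
  have hsum : ∀ u w : ι → ℤ, (∀ i, |u i| ≤ K) → (∀ i, |w i| ≤ K) →
      |∑ i, u i * w i| ≤ Fintype.card ι * K ^ 2 := by
    intro u w hu hw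
    refine (Finset.abs_sum_le_sum_abs _ _).trans ?_
    refine (Finset.sum_le_card_nsmul _ _ (K ^ 2) fun i _ => ?_).trans (by simp)
    rw [abs_mul, pow_two]
    exact mul_le_mul (hu i) (hw i) (abs_nonneg _) ((abs_nonneg _).trans (hu i))
  have hG : ∀ j k, |(Nᵀ * N) j k| ≤ Fintype.card ι * K ^ 2 := fun j k => by
    simpa [mul_apply] using hsum (fun i => N i j) (fun i => N i k) (hN · j) (hN · k)
  have hr : ∀ j, |(Nᵀ *ᵥ h) j| ≤ Fintype.card ι * K ^ 2 := fun j => by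
    simpa [mulVec, dotProduct] using hsum (fun i => N i j) h (hN · j) hh
  have hmap : (Nᵀ * N).map (Int.cast : ℤ → ℝ) =
      (N.map (Int.cast : ℤ → ℝ))ᵀ * N.map (Int.cast : ℤ → ℝ) := by
    ext j k
    simp [mul_apply]
  have hdet : (((Nᵀ * N).det : ℤ) : ℝ) = ((Nᵀ * N).map (Int.cast : ℤ → ℝ)).det :=
    (Int.castRingHom ℝ).map_det _
  refine ⟨(Nᵀ * N).det, cramer (Nᵀ * N) (Nᵀ *ᵥ h), fun h0 => ?_, ?_, fun j => ?_, fun j => ?_⟩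
  · rw [h0, Int.cast_zero] at hdet
    obtain ⟨y, hy0, hy⟩ := exists_mulVec_eq_zero_iff.mpr hdet.symm
    rw [hmap] at hy
    have hker : y ∈ LinearMap.ker
        ((N.map (Int.cast : ℤ → ℝ))ᵀ * N.map (Int.cast : ℤ → ℝ)).mulVecLin := hy
    rw [ker_mulVecLin_transpose_mul_self] at hker
    exact hy0 (hinj y hker)
  · simpa using det_le (abv := AbsoluteValue.abs) (A := Nᵀ * N) hG
  · rw [cramer_apply]
    have := det_le (abv := AbsoluteValue.abs) (A := (Nᵀ * N).updateCol j (Nᵀ *ᵥ h))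
      (x := Fintype.card ι * K ^ 2) fun a c => by
        rw [updateCol_apply]
        split_ifs
        · exact hr a
        · exact hG a c
    simpa using this
  · have h1 : (Nᵀ * N).map (Int.cast : ℤ → ℝ) *ᵥ x = fun j => (((Nᵀ *ᵥ h) j : ℤ) : ℝ) := by
      rw [hmap, ← mulVec_mulVec, hx]
      funext j
      simp [mulVec, dotProduct]
    have h2 := congrFun (congrArg (adjugate ((Nᵀ * N).map (Int.cast : ℤ → ℝ)) *ᵥ ·) h1) j
    simp only [mulVec_mulVec, adjugate_mul, smul_mulVec, one_mulVec, Pi.smul_apply,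
      smul_eq_mul] at h2
    rw [hdet, h2, cramer_eq_adjugate_mulVec]
    have h3 : adjugate ((Nᵀ * N).map (Int.cast : ℤ → ℝ)) =
        (adjugate (Nᵀ * N)).map (Int.cast : ℤ → ℝ) :=
      ((Int.castRingHom ℝ).map_adjugate (Nᵀ * N)).symm
    rw [h3]
    generalize Nᵀ *ᵥ h = r
    simp [mulVec, dotProduct]

theorem natAbs_num_le_of_encodingLength_le {r : ℚ} {α : ℕ} (h : encodingLength r ≤ α) :
    r.num.natAbs ≤ 2 ^ α ∧ r.den ≤ 2 ^ α := by
  unfold encodingLength at h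
  constructor
  · have h1 := Nat.le_pow_clog one_lt_two (r.num.natAbs + 1)
    have h2 : 2 ^ Nat.clog 2 (r.num.natAbs + 1) ≤ 2 ^ α := Nat.pow_le_pow_right (by norm_num) (by omega)
    omega
  · have h1 := Nat.le_pow_clog one_lt_two (r.den + 1)
    have h2 : 2 ^ Nat.clog 2 (r.den + 1) ≤ 2 ^ α := Nat.pow_le_pow_right (by norm_num) (by omega)
    omega

/-- Clearing the denominators of a finite family of rationals of bounded encoding length. -/
theorem exists_common_denominator {ι : Type*} [Fintype ι] (r : ι → ℚ) {α : ℕ}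
    (h : ∀ i, encodingLength (r i) ≤ α) :
    ∃ (D : ℕ) (z : ι → ℤ), 0 < D ∧ (∀ i, (D : ℚ) * r i = z i) ∧
      ∀ i, |z i| ≤ 2 ^ (α * (Fintype.card ι + 1)) := by
  have hint : ∀ i, ∃ k : ℤ, ((∏ i, (r i).den : ℕ) : ℚ) * r i = k := fun i => by
    obtain ⟨e, he⟩ := Finset.dvd_prod_of_mem (fun i => (r i).den) (Finset.mem_univ i)
    refine ⟨e * (r i).num, ?_⟩
    have h1 : ((∏ i, (r i).den : ℕ) : ℚ) = (r i).den * e := by exact_mod_cast he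
    push_cast at h1 ⊢
    rw [h1, ← Rat.mul_den_eq_num (r i)]
    ring
  choose z hz using hint
  refine ⟨∏ i, (r i).den, z, Finset.prod_pos fun i _ => (r i).pos, hz, fun i => ?_⟩
  -- The denominators contribute `α` bits each; the extra `+ 1` in the final exponent pays for the
  -- numerator.
  have hD : ∏ i, (r i).den ≤ 2 ^ (α * Fintype.card ι) := by
    rw [pow_mul]
    refine (Finset.prod_le_pow_card _ _ (2 ^ α) fun i _ => ?_).trans (by simp)
    exact (natAbs_num_le_of_encodingLength_le (h i)).2
  have hr : |r i| ≤ 2 ^ α := by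
    have h1 : |r i| ≤ |((r i).num : ℚ)| := by
      conv_lhs => rw [← Rat.num_div_den (r i)]
      rw [abs_div, Nat.abs_cast]
      exact div_le_self (abs_nonneg _) (by exact_mod_cast (r i).pos)
    refine h1.trans ?_
    rw [← Int.cast_abs, Int.abs_eq_natAbs]
    exact_mod_cast (natAbs_num_le_of_encodingLength_le (h i)).1
  have hDq : ((∏ i, (r i).den : ℕ) : ℚ) ≤ 2 ^ (α * Fintype.card ι) := by exact_mod_cast hD
  have : |(z i : ℚ)| ≤ 2 ^ (α * (Fintype.card ι + 1)) := by
    rw [← hz, abs_mul, Nat.abs_cast, mul_add, mul_one, pow_add]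
    exact mul_le_mul hDq hr (abs_nonneg _) (by positivity)
  exact_mod_cast this

/-- The (scaled) slacks of a basic solution of an integer system are zero or bounded away from
zero, and they are bounded above. -/
theorem IsBasic.slack_bounds {mA mB n : ℕ} {A : Matrix (Fin mA) (Fin n) ℝ} {b : Fin mA → ℝ}
    {B : Matrix (Fin mB) (Fin n) ℝ} {d : Fin mB → ℝ} {D K : ℕ} (hD : 0 < D) (hK : 0 < K)
    {IA : Matrix (Fin mA) (Fin n) ℤ} {Ib : Fin mA → ℤ} {IB : Matrix (Fin mB) (Fin n) ℤ}
    {Id : Fin mB → ℤ} (hA : ∀ i j, (D : ℝ) * A i j = IA i j) (hb : ∀ i, (D : ℝ) * b i = Ib i)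
    (hB : ∀ i j, (D : ℝ) * B i j = IB i j) (hd : ∀ i, (D : ℝ) * d i = Id i)
    (hA' : ∀ i j, |IA i j| ≤ K) (hb' : ∀ i, |Ib i| ≤ K)
    (hB' : ∀ i j, |IB i j| ≤ K) (hd' : ∀ i, |Id i| ≤ K)
    {x : Fin n → ℝ} (hx : x ∈ polyhedron A b B d) (hxb : IsBasic A B d x)
    {Y : ℝ} (hY : Y = (n.factorial * ((mA + mB) * K ^ 2) ^ n : ℝ)) (i : Fin mB) :
    (d i - (B *ᵥ x) i = 0 ∨ 1 ≤ D * (d i - (B *ᵥ x) i) * Y) ∧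
      D * (d i - (B *ᵥ x) i) ≤ (n + 1) * K * Y := by
  classical
  have hD0 : (0 : ℝ) < D := by exact_mod_cast hD
  -- Non-tight rows are zeroed rather than deleted, which keeps the index type fixed; basicness says
  -- that `N` has full column rank.
  let N : Matrix (Fin mA ⊕ Fin mB) (Fin n) ℤ :=
    fromRows IA (of fun i j => if (B *ᵥ x) i = d i then IB i j else 0)
  let h : Fin mA ⊕ Fin mB → ℤ := Sum.elim Ib fun i => if (B *ᵥ x) i = d i then Id i else 0
  have hNl : ∀ y i, (N.map (Int.cast : ℤ → ℝ) *ᵥ y) (Sum.inl i) = D * (A *ᵥ y) i := by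
    intro y i
    simp only [mulVec, dotProduct, Finset.mul_sum, map_apply, N, fromRows_apply_inl, ← hA,
      mul_assoc]
  have hBs : ∀ (y : Fin n → ℝ) i, ∑ j, (IB i j : ℝ) * y j = D * (B *ᵥ y) i := by
    intro y i
    simp only [mulVec, dotProduct, Finset.mul_sum, ← hB, mul_assoc]
  have hNr : ∀ y i, (N.map (Int.cast : ℤ → ℝ) *ᵥ y) (Sum.inr i) =
      if (B *ᵥ x) i = d i then D * (B *ᵥ y) i else 0 := by
    intro y i
    rw [← hBs]
    by_cases hi : (B *ᵥ x) i = d i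
    · rw [if_pos hi, mulVec, dotProduct]
      simp only [map_apply, N, fromRows_apply_inr, of_apply, if_pos hi]
    · rw [if_neg hi, mulVec, dotProduct]
      simp only [map_apply, N, fromRows_apply_inr, of_apply, if_neg hi, Int.cast_zero, zero_mul,
        Finset.sum_const_zero]
  obtain ⟨Z, q, hZ0, hZ, hq, hZq⟩ := exists_int_solution_bound N h K
    (by
      rintro (i | i) j
      · exact hA' i j
      · simp only [N, fromRows_apply_inr, of_apply]
        split_ifs
        · exact hB' i j
        · simp)
    (by
      rintro (i | i)
      · exact hb' i
      · simp only [h, Sum.elim_inr]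
        split_ifs
        · exact hd' i
        · simp) x
    (by
      funext i
      rcases i with i | i
      · rw [hNl, hx.1, hb]; rfl
      · rw [hNr]
        simp only [h, Sum.elim_inr]
        split_ifs with hi
        · rw [hi, hd]
        · simp)
    (by
      intro y hy
      refine hxb y (funext fun i => ?_) fun i hi => ?_
      · have := congrFun hy (Sum.inl i)
        rw [hNl] at this
        simpa [hD0.ne'] using this
      · have := congrFun hy (Sum.inr i)
        rw [hNr, if_pos hi] at this
        simpa [hD0.ne'] using this)
  have hYr : |(Z : ℝ)| ≤ Y ∧ ∀ j, |(q j : ℝ)| ≤ Y := by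
    simp only [Fintype.card_sum, Fintype.card_fin] at hZ hq
    rw [hY]
    exact ⟨by exact_mod_cast hZ, fun j => by exact_mod_cast hq j⟩
  have hZ1 : 1 ≤ |(Z : ℝ)| := by exact_mod_cast Int.one_le_abs hZ0
  have hY0 : 0 < Y := by linarith [hYr.1]
  set s := D * (d i - (B *ᵥ x) i) with hs
  have hs0 : 0 ≤ s := mul_nonneg hD0.le (sub_nonneg.mpr (hx.2 i))
  -- The scaled slack times the denominator `Z` is an integer, hence zero or at least 1 in absolute
  -- value, while `1 ≤ |Z| ≤ Y`. The same formula has `n + 1` terms of size at most `K * Y`.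
  have hZs : (Z : ℝ) * s = ((Z * Id i - ∑ j, IB i j * q j : ℤ) : ℝ) := by
    push_cast
    rw [hs, mul_sub, hd, ← hBs, mul_sub, Finset.mul_sum]
    congr 1
    refine Finset.sum_congr rfl fun j _ => ?_
    rw [← hZq]
    ring
  constructor
  · rcases eq_or_ne (d i - (B *ᵥ x) i) 0 with h0 | h0
    · exact Or.inl h0
    · right
      have h1 : (Z : ℝ) * s ≠ 0 := mul_ne_zero (by exact_mod_cast hZ0) (mul_ne_zero hD0.ne' h0)
      rw [hZs] at h1
      have h2 : (1 : ℝ) ≤ |(Z : ℝ) * s| := by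
        rw [hZs]
        exact_mod_cast Int.one_le_abs (by exact_mod_cast h1)
      rw [abs_mul, abs_of_nonneg hs0] at h2
      nlinarith [hYr.1]
  · have h1 : |(Z : ℝ) * s| ≤ (n + 1) * K * Y := by
      rw [hZs]
      push_cast
      have h2 : |(Z : ℝ) * Id i| ≤ K * Y := by
        rw [abs_mul, mul_comm]
        exact mul_le_mul (by exact_mod_cast hd' i) hYr.1 (abs_nonneg _) (by positivity)
      have h3 : |∑ j, (IB i j : ℝ) * q j| ≤ n * (K * Y) := by
        refine (Finset.abs_sum_le_sum_abs _ _).trans ?_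
        refine (Finset.sum_le_card_nsmul _ _ (K * Y) fun j _ => ?_).trans (by simp)
        rw [abs_mul]
        exact mul_le_mul (by exact_mod_cast hB' i j) (hYr.2 j) (abs_nonneg _) (by positivity)
      refine (abs_sub _ _).trans ?_
      linarith
    rw [abs_mul, abs_of_nonneg hs0] at h1
    nlinarith

end Bounds

/-! ### Counting the steps -/

section Diameter

theorem le_encodingLength_of_maxEncodingLength_le {mA mB n : ℕ} {A : Matrix (Fin mA) (Fin n) ℚ}
    {b : Fin mA → ℚ} {B : Matrix (Fin mB) (Fin n) ℚ} {d : Fin mB → ℚ} {α : ℕ}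
    (h : maxEncodingLength A b B d ≤ α) :
    (∀ i j, encodingLength (A i j) ≤ α) ∧ (∀ i, encodingLength (b i) ≤ α) ∧
      (∀ i j, encodingLength (B i j) ≤ α) ∧ ∀ i, encodingLength (d i) ≤ α := by
  simpa [maxEncodingLength, and_assoc] using h

/-- A basic point forces `A` and `B` to have trivial common kernel; this is what removes `n` from
the final bound. -/
theorem IsBasic.card_le {mA mB n : ℕ} {A : Matrix (Fin mA) (Fin n) ℝ}
    {B : Matrix (Fin mB) (Fin n) ℝ} {d : Fin mB → ℝ} {x : Fin n → ℝ} (h : IsBasic A B d x) :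
    n ≤ mA + mB := by
  have hinj : Function.Injective (A.mulVecLin.prod B.mulVecLin) := by
    rw [← LinearMap.ker_eq_bot, LinearMap.ker_eq_bot']
    intro y hy
    exact h.eq_zero y (congrArg Prod.fst hy) (congrArg Prod.snd hy)
  simpa using LinearMap.finrank_le_finrank_of_injective hinj

/-- Each block of `m` steps contributes a factor of at most `e⁻¹ ≤ 1 / 2`. -/
theorem one_sub_inv_pow_mul_le (m L : ℕ) (hm : 0 < m) :
    (1 - 1 / (m : ℝ)) ^ (m * L) ≤ (1 / 2) ^ L := by
  have hm' : (1 : ℝ) ≤ m := by exact_mod_cast hm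
  have h0 : (0 : ℝ) ≤ 1 - 1 / m := by
    rw [sub_nonneg, div_le_one (by linarith)]
    exact hm'
  rw [pow_mul]
  refine pow_le_pow_left₀ (pow_nonneg h0 m) ?_ L
  refine (Real.one_sub_div_pow_le_exp_neg (n := m) (t := 1) hm').trans ?_
  rw [Real.exp_neg, one_div]
  refine inv_anti₀ two_pos ?_
  linarith [Real.add_one_le_exp (1 : ℝ)]

theorem factorial_mul_pow_le {m n κ : ℕ} (hnm : n ≤ m) :
    n.factorial * (m * (2 ^ κ) ^ 2) ^ n ≤ 2 ^ (m * m + (m + 2 * κ) * m) := by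
  have hm : m ≤ 2 ^ m := Nat.lt_two_pow_self.le
  have h1 : n.factorial ≤ 2 ^ (m * m) := by
    refine (Nat.factorial_le hnm).trans ((Nat.factorial_le_pow m).trans ?_)
    rw [pow_mul]
    exact Nat.pow_le_pow_left hm m
  have h2 : (m * (2 ^ κ) ^ 2) ^ n ≤ 2 ^ ((m + 2 * κ) * m) := by
    have h3 : m * (2 ^ κ) ^ 2 ≤ 2 ^ (m + 2 * κ) := by
      rw [pow_add, ← pow_mul, mul_comm κ 2]
      exact Nat.mul_le_mul_right _ hm
    rw [pow_mul]
    exact (Nat.pow_le_pow_left h3 n).trans (Nat.pow_le_pow_right (by positivity) hnm)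
  rw [pow_add]
  exact Nat.mul_le_mul h1 h2

/-- The number of times the slack has to be halved. -/
def halvings (m κ : ℕ) : ℕ :=
  2 * m + κ + 2 * (m * m + (m + 2 * κ) * m) + 1

theorem circuitDist_le_of_isBasic {mA mB n : ℕ} (A : Matrix (Fin mA) (Fin n) ℚ) (b : Fin mA → ℚ)
    (B : Matrix (Fin mB) (Fin n) ℚ) (d : Fin mB → ℚ) {α κ : ℕ}
    (h : maxEncodingLength A b B d ≤ α) (hκ : κ = α * ((mA + mB) * (mA + mB + 1) + 1))
    {u v : Fin n → ℝ}
    (hu : u ∈ polyhedron (A.map fun q => (q : ℝ)) (fun i => (b i : ℝ)) (B.map fun q => (q : ℝ))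
      fun i => (d i : ℝ))
    (hv : v ∈ polyhedron (A.map fun q => (q : ℝ)) (fun i => (b i : ℝ)) (B.map fun q => (q : ℝ))
      fun i => (d i : ℝ))
    (hub : IsBasic (A.map fun q => (q : ℝ)) (B.map fun q => (q : ℝ)) (fun i => (d i : ℝ)) u)
    (hvb : IsBasic (A.map fun q => (q : ℝ)) (B.map fun q => (q : ℝ)) (fun i => (d i : ℝ)) v) :
    circuitDist (A.map fun q => (q : ℝ)) (fun i => (b i : ℝ)) (B.map fun q => (q : ℝ))
      (fun i => (d i : ℝ)) u v ≤ (mB * halvings (mA + mB) κ : ℕ) + mB := by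
  classical
  have hnm := hvb.card_le
  obtain ⟨hα1, hα2, hα3, hα4⟩ := le_encodingLength_of_maxEncodingLength_le h
  -- All coefficients form one family, with `none` as the right-hand-side column. It has `(mA + mB)
  -- * (n + 1)` members, and `n ≤ mA + mB` gives the exponent `κ`.
  let r : (Fin mA ⊕ Fin mB) × Option (Fin n) → ℚ := fun p =>
    p.2.elim (Sum.elim b d p.1) fun j => Sum.elim (fun i => A i j) (fun i => B i j) p.1
  obtain ⟨D, z, hD, hDz, hz⟩ := exists_common_denominator r (α := α) (by
    rintro ⟨i | i, _ | j⟩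
    exacts [hα2 i, hα1 i j, hα4 i, hα3 i j])
  have hzK : ∀ p, |z p| ≤ ((2 ^ κ : ℕ) : ℤ) := fun p => by
    refine (hz p).trans ?_
    push_cast
    refine pow_le_pow_right₀ (by norm_num) ?_
    rw [hκ]
    refine Nat.mul_le_mul_left _ ?_
    simp only [Fintype.card_prod, Fintype.card_sum, Fintype.card_fin, Fintype.card_option]
    gcongr
  have hDz' : ∀ p, (D : ℝ) * (r p : ℝ) = z p := fun p => by exact_mod_cast hDz p
  set A' : Matrix (Fin mA) (Fin n) ℝ := A.map fun q => (q : ℝ)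
  set b' : Fin mA → ℝ := fun i => (b i : ℝ)
  set B' : Matrix (Fin mB) (Fin n) ℝ := B.map fun q => (q : ℝ)
  set d' : Fin mB → ℝ := fun i => (d i : ℝ)
  obtain ⟨Y, hY⟩ : ∃ Y : ℝ, Y = n.factorial * ((mA + mB) * ((2 ^ κ : ℕ) : ℝ) ^ 2) ^ n := ⟨_, rfl⟩
  have hbd : ∀ x ∈ polyhedron A' b' B' d', IsBasic A' B' d' x → ∀ i,
      (d' i - (B' *ᵥ x) i = 0 ∨ 1 ≤ D * (d' i - (B' *ᵥ x) i) * Y) ∧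
      D * (d' i - (B' *ᵥ x) i) ≤ (n + 1) * ((2 ^ κ : ℕ) : ℝ) * Y := fun x hx hxb i =>
    IsBasic.slack_bounds (IA := of fun i j => z (Sum.inl i, some j))
      (Ib := fun i => z (Sum.inl i, none)) (IB := of fun i j => z (Sum.inr i, some j))
      (Id := fun i => z (Sum.inr i, none)) hD (by positivity)
      (fun i j => hDz' (Sum.inl i, some j)) (fun i => hDz' (Sum.inl i, none))
      (fun i j => hDz' (Sum.inr i, some j)) (fun i => hDz' (Sum.inr i, none))
      (fun i j => hzK _) (fun i => hzK _) (fun i j => hzK _) (fun i => hzK _) hx hxb hY i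
  have hD0 : (0 : ℝ) < D := by exact_mod_cast hD
  -- With no inequalities the factor `1 - 1 / mB` is 1 by convention and nothing shrinks, but the
  -- potential is an empty sum.
  rcases Nat.eq_zero_or_pos mB with hmB | hmB
  · have h0 : tightSlack B' d' v u = 0 := by
      subst hmB
      simp [tightSlack]
    rw [eq_of_tightSlack_eq_zero hv hvb hu h0, circuitDist_self hv]
    simp
  have hm0 : (0 : ℝ) < mA + mB := by
    have : (0 : ℝ) < mB := by exact_mod_cast hmB
    positivity
  have hY0 : 0 < Y := by rw [hY]; positivity
  have hYle : Y ≤ 2 ^ ((mA + mB) * (mA + mB) + (mA + mB + 2 * κ) * (mA + mB)) := by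
    rw [hY]
    exact_mod_cast factorial_mul_pow_le (κ := κ) hnm
  refine circuitDist_le_of_tightSlack_mul_pow_lt (ε := 1 / (D * Y))
    (fun g hg => exists_smul_mem_circuits A B hvb.eq_zero hg) hv hvb ?_ _ hu ?_
  · intro x hx hxb hlt
    refine Finset.sum_eq_zero fun i hi => ?_
    refine (hbd x hx hxb i).1.resolve_right fun h1 => hlt.not_ge ?_
    have h2 : d' i - (B' *ᵥ x) i ≤ tightSlack B' d' v x :=
      Finset.single_le_sum (f := fun i => d' i - (B' *ᵥ x) i)
        (fun i _ => sub_nonneg.mpr (hx.2 i)) hi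
    refine le_trans ?_ h2
    rw [div_le_iff₀ (by positivity)]
    linarith
  · have h1 : D * tightSlack B' d' v u ≤ mB * ((n + 1) * ((2 ^ κ : ℕ) : ℝ) * Y) := by
      rw [tightSlack, Finset.mul_sum]
      refine (Finset.sum_le_card_nsmul _ _ _ fun i _ => (hbd u hu hub i).2).trans ?_
      rw [nsmul_eq_mul]
      refine mul_le_mul_of_nonneg_right ?_ (by positivity)
      exact_mod_cast (Finset.card_le_univ _).trans (by simp)
    set m := mA + mB with hm
    set E := m * m + (m + 2 * κ) * m with hE
    -- One factor `Y` comes from the upper bound on the slack, the other from `ε = 1 / (D * Y)`. The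
    -- `+ 1` in `halvings` makes the final inequality strict.
    have h2 : D * tightSlack B' d' v u * Y ≤ 2 ^ (2 * m + κ + 2 * E) := by
      have h3 : (mB : ℝ) ≤ 2 ^ m := by
        exact_mod_cast (show mB ≤ m by omega).trans Nat.lt_two_pow_self.le
      have h4 : (n + 1 : ℝ) ≤ 2 ^ m := by
        exact_mod_cast (show n + 1 ≤ m + 1 by omega).trans Nat.lt_two_pow_self
      calc D * tightSlack B' d' v u * Y ≤ mB * ((n + 1) * ((2 ^ κ : ℕ) : ℝ) * Y) * Y := by gcongr
        _ ≤ 2 ^ m * (2 ^ m * ((2 ^ κ : ℕ) : ℝ) * 2 ^ E) * 2 ^ E := by gcongr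
        _ = 2 ^ (2 * m + κ + 2 * E) := by
          push_cast
          ring
    have h5 := one_sub_inv_pow_mul_le mB (halvings m κ) hmB
    have h6 : (2 : ℝ) ^ (2 * m + κ + 2 * E) * (1 / 2) ^ halvings m κ < 1 := by
      rw [halvings, ← hE, pow_succ, ← mul_assoc, ← mul_pow]
      norm_num
    rw [lt_div_iff₀ (by positivity)]
    have h7 : 0 ≤ tightSlack B' d' v u := tightSlack_nonneg hu
    calc tightSlack B' d' v u * (1 - 1 / mB) ^ (mB * halvings m κ) * (D * Y)
        = D * tightSlack B' d' v u * Y * (1 - 1 / mB) ^ (mB * halvings m κ) := by ring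
      _ ≤ D * tightSlack B' d' v u * Y * (1 / 2) ^ halvings m κ := by gcongr
      _ ≤ 2 ^ (2 * m + κ + 2 * E) * (1 / 2) ^ halvings m κ := by gcongr
      _ < 1 := h6

end Diameter

end CircuitPaths

theorem corollary6 :
    ∃ f : MvPolynomial (Fin 2) ℕ,
      ∀ (mA mB n : ℕ) (A : Matrix (Fin mA) (Fin n) ℚ) (b : Fin mA → ℚ)
        (B : Matrix (Fin mB) (Fin n) ℚ) (d : Fin mB → ℚ) (α : ℕ),
        CircuitPaths.maxEncodingLength A b B d ≤ α →
          CircuitPaths.circuitDiameter (A.map fun q => (q : ℝ)) (fun i => (b i : ℝ))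
              (B.map fun q => (q : ℝ)) (fun i => (d i : ℝ)) ≤
            ((MvPolynomial.eval ![mA + mB, α] f : ℕ) : ℕ∞) := by
  let m : MvPolynomial (Fin 2) ℕ := MvPolynomial.X 0
  let κ : MvPolynomial (Fin 2) ℕ := MvPolynomial.X 1 * (m * (m + 1) + 1)
  -- This is `m * halvings m κ + m`: greedy steps plus clean-up steps, with `mB` enlarged to `m`.
  refine ⟨m * (2 * m + κ + 2 * (m * m + (m + 2 * κ) * m) + 1) + m, ?_⟩
  intro mA mB n A b B d α h
  refine iSup₂_le fun u hu => iSup₂_le fun v hv => ?_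
  refine (CircuitPaths.circuitDist_le_of_isBasic A b B d h rfl hu.1 hv.1
    (CircuitPaths.isBasic_of_mem_extremePoints hu)
    (CircuitPaths.isBasic_of_mem_extremePoints hv)).trans ?_
  norm_cast
  simp only [m, κ, map_add, map_mul, map_one, map_ofNat, MvPolynomial.eval_X,
    Matrix.cons_val_zero, Matrix.cons_val_one, CircuitPaths.halvings]
  gcongr <;> omega
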